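/- Let $K$ be a field of characteristic zero and let $\delta\in K$ with $\delta\neq 1$. A $\delta$-Novikov algebra over $K$ is a $K$-vector space $N$ with a bilinear (not necessarily associative) product such that for all $x,y,z\in N$ $$\delta(xy)z-x(yz)=\delta(yx)z-y(xz),\qquad (xy)z=(xz)y .$$ Its commutator algebra is the vector space $N$ with the product $[a,b]=ab-ba$. Let $F$ be the free nonassociative (nonunital) $K$-algebra on the countably many variables $x_0,x_1,x_2,\dots$. An algebra satisfies the identity $f\in F$ if $f$ vanishes under every substitution of elements of the algebra for the variables. The consequences of a set of identities are the elements of the T-ideal it generates, that is, of the smallest two-sided ideal of $F$ that contains the set and is stable under all algebra endomorphisms of $F$. Theorem. (1) An element $f\in F$ is an identity of the commutator algebras of all $\delta$-Novikov algebras over $K$ if and only if $f$ is a consequence of anticommutativity $x_0x_1+x_1x_0$, the Jacobi identity $(x_0x_1)x_2+(x_1x_2)x_0+(x_2x_0)x_1$, and the metabelian identity $(x_0x_1)(x_2x_3)$. (2) The variety generated by the commutator algebras of all $\delta$-Novikov algebras over $K$ (the class of all $K$-algebras satisfying every identity that holds in all these commutator algebras) is exactly the variety of metabelian Lie algebras over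 $K$, that is, of the Lie algebras satisfying $[[a,b],[c,d]]=0$. -/

import Mathlib

universe u v w

noncomputable section

/-- A (left) `δ`-Novikov algebra: a not necessarily associative algebra that is
`δ`-left-symmetric and right commutative. -/
structure IsDeltaNovikov {K : Type u} [Field K] (δ : K) (N : Type w)
    [NonUnitalNonAssocRing N] [Module K N] : Prop where
  left_symm : ∀ x y z : N,
    δ • ((x * y) * z) - x * (y * z) = δ • ((y * x) * z) - y * (x * z)
  right_comm : ∀ x y z : N, (x * y) * z = (x * z) * y

/-- The commutator algebra of an algebra `N`: the same vector space with the product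
`[a, b] = a * b - b * a`. -/
def CommutatorAlgebra (N : Type w) : Type w := N

namespace CommutatorAlgebra

variable {N : Type w}

/-- The identity map from `N` to its commutator algebra. -/
def of : N ≃ CommutatorAlgebra N := Equiv.refl N

instance [NonUnitalNonAssocRing N] : AddCommGroup (CommutatorAlgebra N) :=
  inferInstanceAs (AddCommGroup N)

instance {K : Type u} [Field K] [NonUnitalNonAssocRing N] [Module K N] :
    Module K (CommutatorAlgebra N) :=
  inferInstanceAs (Module K N)

instance [NonUnitalNonAssocRing N] : Mul (CommutatorAlgebra N) where
  mul a b := of (of.symm a * of.symm b - of.symm b * of.symm a)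

theorem of_mul_of [NonUnitalNonAssocRing N] (a b : N) : of a * of b = of (a * b - b * a) := rfl

theorem of_add [NonUnitalNonAssocRing N] (a b : N) : of (a + b) = of a + of b := rfl

theorem of_zero [NonUnitalNonAssocRing N] : of (0 : N) = 0 := rfl

theorem of_smul {K : Type u} [Field K] [NonUnitalNonAssocRing N] [Module K N] (c : K) (a : N) :
    of (c • a) = c • of a := rfl

instance [NonUnitalNonAssocRing N] : NonUnitalNonAssocRing (CommutatorAlgebra N) where
  left_distrib := fun a b c => by
    have key : ∀ a b c : N, a * (b + c) - (b + c) * a = (a * b - b * a) + (a * c - c * a) := by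
      intro a b c; rw [mul_add, add_mul]; abel
    exact key a b c
  right_distrib := fun a b c => by
    have key : ∀ a b c : N, (a + b) * c - c * (a + b) = (a * c - c * a) + (b * c - c * b) := by
      intro a b c; rw [mul_add, add_mul]; abel
    exact key a b c
  zero_mul := fun a => by
    have key : ∀ a : N, 0 * a - a * 0 = 0 := by intro a; simp
    exact key a
  mul_zero := fun a => by
    have key : ∀ a : N, a * 0 - 0 * a = 0 := by intro a; simp
    exact key a

instance {K : Type u} [Field K] [NonUnitalNonAssocRing N] [Module K N]
    [IsScalarTower K N N] [SMulCommClass K N N] :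
    IsScalarTower K (CommutatorAlgebra N) (CommutatorAlgebra N) where
  smul_assoc := fun c a b => by
    have key : ∀ a b : N, (c • a) * b - b * (c • a) = c • (a * b - b * a) := by
      intro a b; rw [smul_mul_assoc, mul_smul_comm, smul_sub]
    exact key a b

instance {K : Type u} [Field K] [NonUnitalNonAssocRing N] [Module K N]
    [IsScalarTower K N N] [SMulCommClass K N N] :
    SMulCommClass K (CommutatorAlgebra N) (CommutatorAlgebra N) where
  smul_comm := fun c a b => by
    have key : ∀ a b : N, c • (a * b - b * a) = a * (c • b) - (c • b) * a := by
      intro a b; rw [smul_mul_assoc, mul_smul_comm, smul_sub]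
    exact key a b

end CommutatorAlgebra

/-- Nonassociative polynomials without constant term in countably many variables over `K`. -/
abbrev NAPoly (K : Type u) [Field K] : Type u := FreeNonUnitalNonAssocAlgebra K ℕ

/-- The `i`-th variable. -/
abbrev NAPoly.X (K : Type u) [Field K] (i : ℕ) : NAPoly K := FreeNonUnitalNonAssocAlgebra.of K i

/-- The algebra `A` satisfies the identity `f = 0`: every substitution of elements of `A` for the
variables makes `f` vanish, the formal product being read as the product of `A`. -/
def SatisfiesIdentity (K : Type u) [Field K] (A : Type w) [NonUnitalNonAssocRing A] [Module K A]
    [IsScalarTower K A A] [SMulCommClass K A A] (f : NAPoly K) : Prop :=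
  ∀ a : ℕ → A, FreeNonUnitalNonAssocAlgebra.lift K a f = 0

/-- A T-ideal: a two-sided ideal (and linear subspace) of the free nonassociative algebra that is
stable under all substitutions of polynomials for the variables. -/
structure IsTIdeal {K : Type u} [Field K] (I : Submodule K (NAPoly K)) : Prop where
  mul_left_mem : ∀ (g : NAPoly K) {f : NAPoly K}, f ∈ I → g * f ∈ I
  mul_right_mem : ∀ (g : NAPoly K) {f : NAPoly K}, f ∈ I → f * g ∈ I
  map_mem : ∀ (φ : NAPoly K →ₙₐ[K] NAPoly K) {f : NAPoly K}, f ∈ I → φ f ∈ I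

/-- The T-ideal generated by a set `E` of polynomials, that is, the set of all consequences of the
identities `e = 0`, `e ∈ E`. -/
def identityConsequences {K : Type u} [Field K] (E : Set (NAPoly K)) : Submodule K (NAPoly K) :=
  sInf {I | IsTIdeal I ∧ E ⊆ I}

/-- Anticommutativity, as a polynomial. -/
def anticommPoly (K : Type u) [Field K] : NAPoly K :=
  NAPoly.X K 0 * NAPoly.X K 1 + NAPoly.X K 1 * NAPoly.X K 0

/-- The Jacobi identity, as a polynomial. -/
def jacobiPoly (K : Type u) [Field K] : NAPoly K :=
  (NAPoly.X K 0 * NAPoly.X K 1) * NAPoly.X K 2 + (NAPoly.X K 1 * NAPoly.X K 2) * NAPoly.X K 0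
    + (NAPoly.X K 2 * NAPoly.X K 0) * NAPoly.X K 1

/-- The metabelian identity, as a polynomial. -/
def metabelianPoly (K : Type u) [Field K] : NAPoly K :=
  (NAPoly.X K 0 * NAPoly.X K 1) * (NAPoly.X K 2 * NAPoly.X K 3)

/-- The identities that hold for the commutator product in all `δ`-Novikov algebras over `K`. -/
def commutatorIdentities {K : Type u} [Field K] (δ : K) : Set (NAPoly K) :=
  {f | ∀ (N : Type (max u v)) [NonUnitalNonAssocRing N] [Module K N] [IsScalarTower K N N]
    [SMulCommClass K N N], IsDeltaNovikov δ N → SatisfiesIdentity K (CommutatorAlgebra N) f}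

/-- `A` lies in the variety generated by the commutator algebras of all `δ`-Novikov algebras: it
satisfies every identity that all these commutator algebras satisfy. -/
def MemCommutatorVariety {K : Type u} [Field K] (δ : K) (A : Type w) [NonUnitalNonAssocRing A]
    [Module K A] [IsScalarTower K A A] [SMulCommClass K A A] : Prop :=
  ∀ f ∈ commutatorIdentities.{u, v} δ, SatisfiesIdentity K A f

/-- An algebra (with product written `*`) is a metabelian Lie algebra. Over a field of
characteristic zero anticommutativity is the same as `a * a = 0`. -/
structure IsMetabelianLie (A : Type w) [NonUnitalNonAssocRing A] : Prop where
  anticomm : ∀ a b : A, a * b = -(b * a)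
  jacobi : ∀ a b c : A, (a * b) * c + (b * c) * a + (c * a) * b = 0
  metabelian : ∀ a b c d : A, (a * b) * (c * d) = 0

end

/-!
The commutator of a `δ`-Novikov algebra always satisfies the Jacobi identity. For `δ ≠ 1`, expanding
`x * ((y * w) * z) = x * ((y * z) * w)` by left symmetry gives
`(y * w) * (x * z) = (y * z) * (x * w)` (`IsDeltaNovikov.mul_mul_mul_swap`), and with it every
commutator of commutators cancels. So the consequences of the metabelian Lie identities hold in all
these commutator algebras.

Conversely, a single algebra detects every other identity. The algebra `TwoDim δ` with basis `e, m`
and products `e * e = δ • e`, `m * e = m`, `e * m = m * m = 0` is `δ`-Novikov, and its commutator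
algebra is the nonabelian two-dimensional Lie algebra. Modulo the metabelian Lie identities every
polynomial is a combination of generators and left-normed words `[x_i, x_k, x_{k₁}, …, x_{kᵣ}]`,
in which the order of `k₁, …, kᵣ` does not matter (`mem_span_spanningSet`). For each multiset `s` of
letters fix a pivot in `s`. By the Jacobi identity the word above is a difference
`w(i, s) - w(k, s)`, where `w(i, s)` is the word that starts with `i` and the pivot, and is `0` when
`i` is the pivot (`IsMetabelianLie.leftNormed_eq_normalForm_sub`).

Under the substitution `x_k ↦ α_k • (e + γ_k • m)` the word takes the value
`(γ_i - γ_k) ∏_{j ∈ s} α_j` at `m`. Record it as the formal difference `(i, s) - (k, s)`. The formal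
combination attached in this way to a polynomial determines the polynomial modulo the metabelian Lie
identities, through `(i, s) ↦ w(i, s)`, and it is determined by the values of the polynomial in
`TwoDim δ`, since the functions `γ_i ∏_{j ∈ s} α_j` are linearly independent over an infinite field
(`exists_toNormalForm`, `eq_zero_of_evalFamily_eq_zero`). An identity of `TwoDim δ` is therefore a
consequence of the metabelian Lie identities. The description of the variety follows formally.
-/

/-! ### Commutator algebras of `δ`-Novikov algebras -/

namespace IsDeltaNovikov

variable {K : Type u} [Field K] {δ : K} {N : Type w} [NonUnitalNonAssocRing N] [Module K N]

/-- The identity that makes commutators metabelian when `δ ≠ 1`. It comes from expanding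
`x * ((y * w) * z) = x * ((y * z) * w)` twice by left symmetry: right commutativity cancels all
terms but `1 - δ` times the difference of the two sides. -/
theorem mul_mul_mul_swap [IsScalarTower K N N] (hN : IsDeltaNovikov δ N) (hδ : δ ≠ 1) (x y z w : N) :
    (y * w) * (x * z) = (y * z) * (x * w) := by
  have expand : ∀ z w : N, x * ((y * w) * z) =
      δ • (δ • (((x * y) * w) * z) - δ • (((y * x) * w) * z) + (y * z) * (x * w))
        - δ • (((y * x) * w) * z) + (y * w) * (x * z) := by
    intro z w
    have h1 := hN.left_symm x (y * w) z
    have h2 : x * (y * w) = δ • ((x * y) * w) - δ • ((y * x) * w) + y * (x * w) := by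
      linear_combination (norm := module) -hN.left_symm x y w
    have h3 : (x * (y * w)) * z
        = δ • (((x * y) * w) * z) - δ • (((y * x) * w) * z) + (y * z) * (x * w) := by
      rw [h2, add_mul, sub_mul, smul_mul_assoc, smul_mul_assoc, hN.right_comm y (x * w) z]
    rw [h3, hN.right_comm y w x] at h1
    linear_combination (norm := module) -h1
  have h := expand z w
  rw [hN.right_comm y w z, expand w z, hN.right_comm (x * y) z w, hN.right_comm (y * x) z w] at h
  have h0 : (1 - δ) • ((y * w) * (x * z) - (y * z) * (x * w)) = 0 := by
    linear_combination (norm := module) -h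
  exact sub_eq_zero.1 ((smul_eq_zero.1 h0).resolve_left (sub_ne_zero.2 hδ.symm))

/-- A commutator of two products is a combination of left-normed products. Its right side is
`δ • (([a, c] * d) * b)`, so alternating it in `a, b` and in `c, d` cancels everything by right
commutativity. -/
theorem mul_mul_mul_sub [IsScalarTower K N N] (hN : IsDeltaNovikov δ N) (hδ : δ ≠ 1) (a b c d : N) :
    (a * b) * (c * d) - (c * d) * (a * b)
      = δ • (((a * c) * d) * b) - δ • (((c * a) * d) * b) := by
  have h2 : a * (c * d) = δ • ((a * c) * d) - δ • ((c * a) * d) + c * (a * d) := by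
    linear_combination (norm := module) -hN.left_symm a c d
  rw [hN.right_comm a b, h2, add_mul, sub_mul, smul_mul_assoc, smul_mul_assoc,
    hN.right_comm c (a * d) b, hN.mul_mul_mul_swap hδ a c d b]
  abel

theorem commutator_metabelian [IsScalarTower K N N] (hN : IsDeltaNovikov δ N) (hδ : δ ≠ 1) (a b c d : N) :
    (a * b - b * a) * (c * d - d * c) - (c * d - d * c) * (a * b - b * a) = 0 := by
  have h1 := hN.mul_mul_mul_sub hδ a b c d
  have h2 := hN.mul_mul_mul_sub hδ a b d c
  have h3 := hN.mul_mul_mul_sub hδ b a c d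
  have h4 := hN.mul_mul_mul_sub hδ b a d c
  have swap : ∀ x y z w : N, ((x * y) * z) * w = ((x * w) * z) * y := fun x y z w => by
    rw [hN.right_comm (x * y), hN.right_comm x y w, hN.right_comm (x * w)]
  rw [hN.right_comm a d c, swap d a c b] at h2
  rw [hN.right_comm b c d, swap c b d a] at h3
  simp only [mul_sub, sub_mul]
  linear_combination (norm := module) h1 - h2 - h3 + h4

/-- The Jacobi identity for the commutator; here `δ` is arbitrary. -/
theorem commutator_jacobi (hN : IsDeltaNovikov δ N) (a b c : N) :
    ((a * b - b * a) * c - c * (a * b - b * a)) + ((b * c - c * b) * a - a * (b * c - c * b))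
      + ((c * a - a * c) * b - b * (c * a - a * c)) = 0 := by
  have h1 := hN.left_symm a b c
  have h2 := hN.left_symm b c a
  have h3 := hN.left_symm c a b
  rw [hN.right_comm a c b] at h3
  rw [hN.right_comm b a c] at h1
  rw [hN.right_comm c b a] at h2
  simp only [mul_sub, sub_mul]
  rw [hN.right_comm a c b, hN.right_comm b a c, hN.right_comm c b a]
  linear_combination (norm := module) h1 + h2 + h3

theorem isMetabelianLie_commutatorAlgebra [IsScalarTower K N N] (hN : IsDeltaNovikov δ N) (hδ : δ ≠ 1) :
    IsMetabelianLie (CommutatorAlgebra N) where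
  anticomm _ _ := (neg_sub (α := N) _ _).symm
  jacobi a b c := hN.commutator_jacobi (N := N) a b c
  metabelian a b c d := hN.commutator_metabelian (N := N) hδ a b c d

end IsDeltaNovikov

/-! ### T-ideals and consequences of identities -/

section TIdeal

variable {K : Type u} [Field K]

theorem isTIdeal_identityConsequences (E : Set (NAPoly K)) : IsTIdeal (identityConsequences E) where
  mul_left_mem g f hf := by
    simp only [identityConsequences, Submodule.mem_sInf, Set.mem_ofPred_eq] at hf ⊢
    exact fun I hI => hI.1.mul_left_mem g (hf I hI)
  mul_right_mem g f hf := by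
    simp only [identityConsequences, Submodule.mem_sInf, Set.mem_ofPred_eq] at hf ⊢
    exact fun I hI => hI.1.mul_right_mem g (hf I hI)
  map_mem φ f hf := by
    simp only [identityConsequences, Submodule.mem_sInf, Set.mem_ofPred_eq] at hf ⊢
    exact fun I hI => hI.1.map_mem φ (hf I hI)

theorem subset_identityConsequences (E : Set (NAPoly K)) :
    E ⊆ (identityConsequences E : Set (NAPoly K)) := by
  intro e he
  simp only [identityConsequences, SetLike.mem_coe, Submodule.mem_sInf, Set.mem_ofPred_eq]
  exact fun I hI => hI.2 he

/-- The identities of an algebra, as a subspace of the free nonassociative algebra. -/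
def identitiesOf (K : Type u) [Field K] (A : Type w) [NonUnitalNonAssocRing A] [Module K A]
    [IsScalarTower K A A] [SMulCommClass K A A] : Submodule K (NAPoly K) where
  carrier := {f | SatisfiesIdentity K A f}
  add_mem' hf hg a := by rw [map_add, hf a, hg a, add_zero]
  zero_mem' a := map_zero _
  smul_mem' c f hf a := by rw [map_smul, hf a, smul_zero]

variable {A : Type w} [NonUnitalNonAssocRing A] [Module K A] [IsScalarTower K A A]
  [SMulCommClass K A A]

theorem isTIdeal_identitiesOf : IsTIdeal (identitiesOf K A) where
  mul_left_mem g f hf a := by rw [map_mul, hf a, mul_zero]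
  mul_right_mem g f hf a := by rw [map_mul, hf a, zero_mul]
  map_mem φ f hf a := by
    have h : (FreeNonUnitalNonAssocAlgebra.lift K a).comp φ
        = FreeNonUnitalNonAssocAlgebra.lift K
          fun i => FreeNonUnitalNonAssocAlgebra.lift K a (φ (NAPoly.X K i)) := by
      refine FreeNonUnitalNonAssocAlgebra.hom_ext _ fun i => ?_
      rw [NonUnitalAlgHom.comp_apply, FreeNonUnitalNonAssocAlgebra.lift_of_apply]
    have := congrArg (fun ψ => ψ f) h
    exact this.trans (hf _)

theorem satisfiesIdentity_anticommPoly_iff :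
    SatisfiesIdentity K A (anticommPoly K) ↔ ∀ a b : A, a * b = -(b * a) := by
  simp only [SatisfiesIdentity, anticommPoly, NAPoly.X, map_add, map_mul,
    FreeNonUnitalNonAssocAlgebra.lift_of_apply]
  refine ⟨fun h a b => eq_neg_of_add_eq_zero_left (h fun n => if n = 0 then a else b),
    fun h a => by rw [h, neg_add_cancel]⟩

theorem satisfiesIdentity_jacobiPoly_iff :
    SatisfiesIdentity K A (jacobiPoly K) ↔
      ∀ a b c : A, (a * b) * c + (b * c) * a + (c * a) * b = 0 := by
  simp only [SatisfiesIdentity, jacobiPoly, NAPoly.X, map_add, map_mul,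
    FreeNonUnitalNonAssocAlgebra.lift_of_apply]
  exact ⟨fun h a b c => h fun n => if n = 0 then a else if n = 1 then b else c,
    fun h a => h _ _ _⟩

theorem satisfiesIdentity_metabelianPoly_iff :
    SatisfiesIdentity K A (metabelianPoly K) ↔ ∀ a b c d : A, (a * b) * (c * d) = 0 := by
  simp only [SatisfiesIdentity, metabelianPoly, NAPoly.X, map_mul,
    FreeNonUnitalNonAssocAlgebra.lift_of_apply]
  exact ⟨fun h a b c d =>
    h fun n => if n = 0 then a else if n = 1 then b else if n = 2 then c else d,
    fun h a => h _ _ _ _⟩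

/-- The T-ideal of the metabelian Lie identities. -/
noncomputable abbrev metabelianTIdeal (K : Type u) [Field K] : Submodule K (NAPoly K) :=
  identityConsequences {anticommPoly K, jacobiPoly K, metabelianPoly K}

theorem IsMetabelianLie.satisfiesIdentity (hA : IsMetabelianLie A) {f : NAPoly K}
    (hf : f ∈ metabelianTIdeal K) : SatisfiesIdentity K A f := by
  have h : metabelianTIdeal K ≤ identitiesOf K A := by
    refine sInf_le ⟨isTIdeal_identitiesOf, ?_⟩
    rintro e (rfl | rfl | rfl)
    · exact satisfiesIdentity_anticommPoly_iff.2 hA.anticomm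
    · exact satisfiesIdentity_jacobiPoly_iff.2 hA.jacobi
    · exact satisfiesIdentity_metabelianPoly_iff.2 hA.metabelian
  exact h hf

theorem isMetabelianLie_of_satisfiesIdentity
    (h : ∀ f ∈ metabelianTIdeal K, SatisfiesIdentity K A f) : IsMetabelianLie A := by
  have hE := subset_identityConsequences {anticommPoly K, jacobiPoly K, metabelianPoly K}
  exact ⟨satisfiesIdentity_anticommPoly_iff.1 (h _ (hE (by simp))),
    satisfiesIdentity_jacobiPoly_iff.1 (h _ (hE (by simp))),
    satisfiesIdentity_metabelianPoly_iff.1 (h _ (hE (by simp)))⟩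

theorem metabelianTIdeal_subset_commutatorIdentities {δ : K} (hδ : δ ≠ 1) {f : NAPoly K}
    (hf : f ∈ metabelianTIdeal K) : f ∈ commutatorIdentities.{u, v} δ :=
  fun _ _ _ _ _ hN => (hN.isMetabelianLie_commutatorAlgebra hδ).satisfiesIdentity hf

/-- Congruence modulo the T-ideal of the metabelian Lie identities. Its quotient is the free
metabelian Lie ring on countably many generators over `K`. -/
noncomputable def metabelianCon (K : Type u) [Field K] : RingCon (NAPoly K) where
  r f g := f - g ∈ metabelianTIdeal K
  iseqv :=
    { refl := fun f => by simp
      symm := fun {f g} h => by simpa using neg_mem h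
      trans := fun {f g k} h h' => by simpa using add_mem h h' }
  add' {f g k l} h h' := by
    have := add_mem h h'
    rwa [sub_add_sub_comm] at this
  mul' {f g k l} h h' := by
    have hT := isTIdeal_identityConsequences {anticommPoly K, jacobiPoly K, metabelianPoly K}
    have := add_mem (hT.mul_right_mem k h) (hT.mul_left_mem g h')
    rwa [sub_mul, mul_sub, sub_add_sub_cancel] at this

/-- The free metabelian Lie algebra on countably many generators, with its ring structure only. -/
abbrev FreeMetabelian (K : Type u) [Field K] : Type u := (metabelianCon K).Quotient

/-- The projection onto the free metabelian Lie ring. -/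
noncomputable def FreeMetabelian.mk (K : Type u) [Field K] : NAPoly K →ₙ+* FreeMetabelian K where
  toFun f := (f : (metabelianCon K).Quotient)
  map_mul' _ _ := rfl
  map_zero' := rfl
  map_add' _ _ := rfl

theorem FreeMetabelian.mk_eq_iff {f g : NAPoly K} :
    FreeMetabelian.mk K f = FreeMetabelian.mk K g ↔ f - g ∈ metabelianTIdeal K :=
  (metabelianCon K).eq

theorem FreeMetabelian.mk_eq_zero_iff {f : NAPoly K} :
    FreeMetabelian.mk K f = 0 ↔ f ∈ metabelianTIdeal K := by
  rw [← map_zero (FreeMetabelian.mk K), FreeMetabelian.mk_eq_iff, sub_zero]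

theorem FreeMetabelian.mk_surjective : Function.Surjective (FreeMetabelian.mk K) :=
  Quotient.mk_surjective

theorem FreeMetabelian.mk_lift_eq_zero {e : NAPoly K}
    (he : e ∈ ({anticommPoly K, jacobiPoly K, metabelianPoly K} : Set (NAPoly K)))
    (a : ℕ → NAPoly K) : FreeMetabelian.mk K (FreeNonUnitalNonAssocAlgebra.lift K a e) = 0 :=
  FreeMetabelian.mk_eq_zero_iff.2 <|
    (isTIdeal_identityConsequences _).map_mem _ (subset_identityConsequences _ he)

theorem FreeMetabelian.isMetabelianLie : IsMetabelianLie (FreeMetabelian K) where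
  anticomm a b := by
    obtain ⟨a, rfl⟩ := mk_surjective a
    obtain ⟨b, rfl⟩ := mk_surjective b
    have h := mk_lift_eq_zero (K := K) (e := anticommPoly K) (by simp)
      fun n => if n = 0 then a else b
    simp only [anticommPoly, NAPoly.X, map_add, map_mul,
      FreeNonUnitalNonAssocAlgebra.lift_of_apply] at h
    exact eq_neg_of_add_eq_zero_left h
  jacobi a b c := by
    obtain ⟨a, rfl⟩ := mk_surjective a
    obtain ⟨b, rfl⟩ := mk_surjective b
    obtain ⟨c, rfl⟩ := mk_surjective c
    have h := mk_lift_eq_zero (K := K) (e := jacobiPoly K) (by simp)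
      fun n => if n = 0 then a else if n = 1 then b else c
    simp only [jacobiPoly, NAPoly.X, map_add, map_mul,
      FreeNonUnitalNonAssocAlgebra.lift_of_apply] at h
    exact h
  metabelian a b c d := by
    obtain ⟨a, rfl⟩ := mk_surjective a
    obtain ⟨b, rfl⟩ := mk_surjective b
    obtain ⟨c, rfl⟩ := mk_surjective c
    obtain ⟨d, rfl⟩ := mk_surjective d
    have h := mk_lift_eq_zero (K := K) (e := metabelianPoly K) (by simp)
      fun n => if n = 0 then a else if n = 1 then b else if n = 2 then c else d
    simp only [metabelianPoly, NAPoly.X, map_mul,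
      FreeNonUnitalNonAssocAlgebra.lift_of_apply] at h
    exact h

/-- Anticommutativity gives `2 • (a * a) = 0`, and `2` is invertible in `K`. -/
theorem FreeMetabelian.mul_self [CharZero K] (a : FreeMetabelian K) : a * a = 0 := by
  obtain ⟨a, rfl⟩ := mk_surjective a
  have h := isMetabelianLie.anticomm (mk K a) (mk K a)
  rw [← map_mul, ← map_neg, mk_eq_iff, sub_neg_eq_add, ← two_smul K] at h
  rw [← map_mul, mk_eq_zero_iff]
  exact ((metabelianTIdeal K).smul_mem_iff two_ne_zero).1 h

end TIdeal

/-! ### Left-normed words -/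

section LeftNormed

/-- The left-normed product `(⋯((m * a k₁) * a k₂) ⋯) * a kᵣ` for the list `k₁, …, kᵣ`. -/
def rightAct {A : Type w} [Mul A] (a : ℕ → A) (m : A) (l : List ℕ) : A :=
  l.foldl (fun m k => m * a k) m

/-- The left-normed word `(⋯((a i * a k) * a k₁) ⋯) * a kᵣ` for the list `k₁, …, kᵣ`. -/
def leftNormed {A : Type w} [Mul A] (a : ℕ → A) (i k : ℕ) (l : List ℕ) : A :=
  rightAct a (a i * a k) l

/-- A letter of a nonempty multiset, chosen once and for all (`0` for the empty multiset). -/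
noncomputable def pivot (s : Multiset ℕ) : ℕ := s.toList.headD 0

theorem pivot_mem {s : Multiset ℕ} (hs : s ≠ 0) : pivot s ∈ s := by
  rw [← Multiset.mem_toList, pivot]
  have h : s.toList ≠ [] := by simpa using hs
  cases hl : s.toList with
  | nil => exact absurd hl h
  | cons b t => simp

/-- The normal form attached to a multiset `s` of letters and a letter `i` of `s`: a generator if
`s = {i}`, and otherwise the left-normed word in the letters of `s` that begins with `i` and the
pivot of `s`, or `0` if `i` is that pivot. -/
noncomputable def normalForm {A : Type w} [Mul A] [Zero A] (a : ℕ → A) (i : ℕ) (s : Multiset ℕ) : A :=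
  if s = {i} then a i
  else if i = pivot s then 0
  else leftNormed a i (pivot s) ((s.erase i).erase (pivot s)).toList

theorem map_leftNormed {A : Type v} {B : Type w} [NonUnitalNonAssocRing A]
    [NonUnitalNonAssocRing B] (φ : A →ₙ+* B) (a : ℕ → A) (i k : ℕ) (l : List ℕ) :
    φ (leftNormed a i k l) = leftNormed (φ ∘ a) i k l := by
  have h : ∀ m, φ (rightAct a m l) = rightAct (φ ∘ a) (φ m) l := by
    induction l with
    | nil => exact fun m => rfl
    | cons b l ih =>
      intro m
      exact (ih _).trans (by rw [map_mul]; rfl)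
  exact (h _).trans (by rw [map_mul]; rfl)

theorem map_normalForm {A : Type v} {B : Type w} [NonUnitalNonAssocRing A]
    [NonUnitalNonAssocRing B] (φ : A →ₙ+* B) (a : ℕ → A) (i : ℕ) (s : Multiset ℕ) :
    φ (normalForm a i s) = normalForm (φ ∘ a) i s := by
  unfold normalForm
  split_ifs
  · rfl
  · exact map_zero φ
  · exact map_leftNormed φ a _ _ _

variable {A : Type w} [NonUnitalNonAssocRing A] {a : ℕ → A}

theorem rightAct_neg (m : A) (l : List ℕ) : rightAct a (-m) l = -rightAct a m l := by
  induction l generalizing m with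
  | nil => rfl
  | cons b l ih => exact (congrArg (rightAct a · l) (neg_mul m (a b))).trans (ih _)

theorem rightAct_sub (m n : A) (l : List ℕ) :
    rightAct a (m - n) l = rightAct a m l - rightAct a n l := by
  induction l generalizing m n with
  | nil => rfl
  | cons b l ih => exact (congrArg (rightAct a · l) (sub_mul m n (a b))).trans (ih _ _)

theorem rightAct_zero (l : List ℕ) : rightAct a (0 : A) l = 0 := by
  simpa using rightAct_sub (a := a) 0 0 l

namespace IsMetabelianLie

/-- Right multiplications by elements commute on products: this is the Jacobi identity for
`x * y, b, c`, whose term in `b * c` vanishes. -/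
theorem mul_mul_mul_comm_right (hA : IsMetabelianLie A) (x y b c : A) :
    ((x * y) * b) * c = ((x * y) * c) * b := by
  have h := hA.jacobi (x * y) b c
  rwa [hA.anticomm (b * c), hA.metabelian, neg_zero, add_zero, hA.anticomm c (x * y), neg_mul,
    add_neg_eq_zero] at h

theorem rightAct_perm (hA : IsMetabelianLie A) {l l' : List ℕ} (h : l.Perm l') (x y : A) :
    rightAct a (x * y) l = rightAct a (x * y) l' := by
  induction h generalizing x y with
  | nil => rfl
  | cons b _ ih => exact ih _ _
  | swap b c l => exact congrArg (rightAct a · l) (hA.mul_mul_mul_comm_right x y _ _)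
  | trans _ _ ih ih' => exact (ih x y).trans (ih' x y)

theorem leftNormed_perm (hA : IsMetabelianLie A) {l l' : List ℕ} (h : l.Perm l') (i k : ℕ) :
    leftNormed a i k l = leftNormed a i k l' := hA.rightAct_perm h _ _

theorem leftNormed_swap (hA : IsMetabelianLie A) (i k : ℕ) (l : List ℕ) :
    leftNormed a i k l = -leftNormed a k i l := by
  rw [leftNormed, leftNormed, hA.anticomm, rightAct_neg]

theorem leftNormed_cons (hA : IsMetabelianLie A) (i k j : ℕ) (l : List ℕ) :
    leftNormed a i k (j :: l) = leftNormed a i j (k :: l) - leftNormed a k j (i :: l) := by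
  have h : (a i * a k) * a j = (a i * a j) * a k - (a k * a j) * a i := by
    have := hA.jacobi (a i) (a k) (a j)
    rw [hA.anticomm (a j) (a i), neg_mul, add_neg_eq_zero] at this
    rw [← this, add_sub_cancel_right]
  exact (congrArg (rightAct a · l) h).trans (rightAct_sub _ _ _)

/-- Every left-normed word is a difference of two normal forms. This is the Jacobi identity,
which moves the pivot of the set of letters to the second place. -/
theorem leftNormed_eq_normalForm_sub (hA : IsMetabelianLie A) (hsq : ∀ x : A, x * x = 0)
    (i k : ℕ) (l : List ℕ) :
    leftNormed a i k l
      = normalForm a i (i ::ₘ k ::ₘ (l : Multiset ℕ))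
        - normalForm a k (i ::ₘ k ::ₘ (l : Multiset ℕ)) := by
  set s : Multiset ℕ := i ::ₘ k ::ₘ (l : Multiset ℕ) with hs
  have hne : ∀ n, s ≠ {n} := fun n h => by
    have := congrArg Multiset.card h
    simp [hs] at this
  have hmem : pivot s ∈ s := pivot_mem (by simp [hs])
  rw [normalForm, normalForm, if_neg (hne _), if_neg (hne _)]
  by_cases hik : i = k
  · subst hik
    rw [sub_self, leftNormed, hsq, rightAct_zero]
  have hsk : s.erase k = i ::ₘ (l : Multiset ℕ) := by
    rw [hs, Multiset.erase_cons_tail _ hik, Multiset.erase_cons_head]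
  have hsi : s.erase i = k ::ₘ (l : Multiset ℕ) := by rw [hs, Multiset.erase_cons_head]
  rw [hsk, hsi]
  by_cases hi : i = pivot s
  · rw [if_pos hi, if_neg (fun h => hik (hi.trans h.symm)), ← hi, Multiset.erase_cons_head,
      zero_sub, ← hA.leftNormed_swap]
    exact hA.leftNormed_perm (Multiset.coe_eq_coe.1 (Multiset.coe_toList _).symm) _ _
  by_cases hk : k = pivot s
  · rw [if_neg hi, if_pos hk, ← hk, Multiset.erase_cons_head, sub_zero]
    exact hA.leftNormed_perm (Multiset.coe_eq_coe.1 (Multiset.coe_toList _).symm) _ _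
  rw [if_neg hi, if_neg hk]
  -- The pivot is neither `i` nor `k`, hence lies in `l`; the Jacobi identity exchanges it with `k`.
  generalize pivot s = j at *
  have hj : j ∈ l := by
    rw [hs, Multiset.mem_cons, Multiset.mem_cons] at hmem
    rcases hmem with h | h | h
    · exact absurd h.symm hi
    · exact absurd h.symm hk
    · exact h
  have hl : ∀ n, n ≠ j →
      ((n ::ₘ (l : Multiset ℕ)).erase j).toList.Perm (n :: l.erase j) := fun n hn => by
    rw [Multiset.erase_cons_tail _ hn, ← Multiset.coe_eq_coe, Multiset.coe_toList]
    rfl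
  rw [hA.leftNormed_perm (List.perm_cons_erase hj), hA.leftNormed_cons,
    hA.leftNormed_perm (hl k hk), hA.leftNormed_perm (hl i hi)]

end IsMetabelianLie

end LeftNormed

/-! ### Reduction to left-normed words -/

section Spanning

variable {K : Type u} [Field K]

/-- A subspace that contains the variables and is closed under products is everything. -/
theorem NAPoly.mem_of_mul_mem (V : Submodule K (NAPoly K)) (hX : ∀ i, NAPoly.X K i ∈ V)
    (hmul : ∀ f ∈ V, ∀ g ∈ V, f * g ∈ V) (f : NAPoly K) : f ∈ V := by
  have hmon : ∀ t : FreeMagma ℕ, (MonoidAlgebra.single t 1 : NAPoly K) ∈ V := fun t => by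
    induction t using FreeMagma.recOnMul with
    | ih1 i => exact hX i
    | ih2 t t' ht ht' => simpa [MonoidAlgebra.single_mul_single] using hmul _ ht _ ht'
  induction f using MonoidAlgebra.induction_linear with
  | zero => exact zero_mem _
  | add f g hf hg => exact add_mem hf hg
  | single t c => simpa [MonoidAlgebra.smul_single] using V.smul_mem c (hmon t)

/-- The generators, the left-normed words of length at least two, and the consequences of the
metabelian Lie identities. -/
def spanningSet (K : Type u) [Field K] : Set (NAPoly K) :=
  {f | (∃ i, f = NAPoly.X K i) ∨ (∃ i k l, f = leftNormed (NAPoly.X K) i k l) ∨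
    f ∈ metabelianTIdeal K}

theorem leftNormed_eq_mul {A : Type w} [Mul A] (a : ℕ → A) (i k : ℕ) (l : List ℕ) :
    ∃ x y, leftNormed a i k l = x * y := by
  induction l using List.reverseRecOn with
  | nil => exact ⟨_, _, rfl⟩
  | append_singleton l b _ => exact ⟨leftNormed a i k l, a b, by simp [leftNormed, rightAct]⟩

/-- Modulo the metabelian Lie identities every polynomial is a combination of generators and
left-normed words: multiplying a word by a generator on the right lengthens it, anticommutativity
handles multiplication on the left, and a product of two words vanishes. -/
theorem mem_span_spanningSet (f : NAPoly K) : f ∈ Submodule.span K (spanningSet K) := by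
  have hT := isTIdeal_identityConsequences {anticommPoly K, jacobiPoly K, metabelianPoly K}
  have hL := FreeMetabelian.isMetabelianLie (K := K)
  have hWX : ∀ i k l b, leftNormed (NAPoly.X K) i k l * NAPoly.X K b
      = leftNormed (NAPoly.X K) i k (l ++ [b]) := fun i k l b => by simp [leftNormed, rightAct]
  have hanti : ∀ g h : NAPoly K, g * h - -(h * g) ∈ metabelianTIdeal K := fun g h => by
    rw [← FreeMetabelian.mk_eq_iff, map_neg, map_mul, map_mul]
    exact hL.anticomm _ _
  refine NAPoly.mem_of_mul_mem _ (fun i => Submodule.subset_span (Or.inl ⟨i, rfl⟩)) ?_ f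
  have key : ∀ g ∈ spanningSet K, ∀ h ∈ spanningSet K,
      g * h ∈ Submodule.span K (spanningSet K) := by
    rintro g (⟨i, rfl⟩ | ⟨i, k, l, rfl⟩ | hg) h (⟨j, rfl⟩ | ⟨j, m, l', rfl⟩ | hh)
    · exact Submodule.subset_span (Or.inr (Or.inl ⟨i, j, [], rfl⟩))
    · rw [← sub_add_cancel (NAPoly.X K i * _) (-(leftNormed (NAPoly.X K) j m l' * NAPoly.X K i))]
      refine add_mem (Submodule.subset_span (Or.inr (Or.inr (hanti _ _)))) (neg_mem ?_)
      exact Submodule.subset_span (Or.inr (Or.inl ⟨j, m, _, hWX _ _ _ _⟩))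
    · exact Submodule.subset_span (Or.inr (Or.inr (hT.mul_left_mem _ hh)))
    · exact Submodule.subset_span (Or.inr (Or.inl ⟨i, k, _, hWX _ _ _ _⟩))
    · refine Submodule.subset_span (Or.inr (Or.inr ?_))
      obtain ⟨x, y, hxy⟩ := leftNormed_eq_mul (NAPoly.X K) i k l
      obtain ⟨x', y', hxy'⟩ := leftNormed_eq_mul (NAPoly.X K) j m l'
      rw [hxy, hxy', ← FreeMetabelian.mk_eq_zero_iff]
      simp only [map_mul]
      exact hL.metabelian _ _ _ _
    · exact Submodule.subset_span (Or.inr (Or.inr (hT.mul_left_mem _ hh)))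
    all_goals exact Submodule.subset_span (Or.inr (Or.inr (hT.mul_right_mem _ hg)))
  have hmap : Submodule.map₂ (LinearMap.mul K (NAPoly K)) (Submodule.span K (spanningSet K))
      (Submodule.span K (spanningSet K)) ≤ Submodule.span K (spanningSet K) := by
    rw [Submodule.map₂_span_span, Submodule.span_le]
    rintro _ ⟨g, hg, h, hh, rfl⟩
    exact key g hg h hh
  exact fun g hg h hh => hmap (Submodule.apply_mem_map₂ _ hg hh)

end Spanning

/-! ### A two-dimensional `δ`-Novikov algebra -/

/-- The algebra with basis `e, m` and products `e * e = δ • e`, `m * e = m`, `e * m = m * m = 0`;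
the pair `(s, t)` stands for `s • e + t • m`. It is `δ`-Novikov for every `δ`, and its commutator
algebra is the nonabelian two-dimensional Lie algebra. The `ULift` only adjusts the universe. -/
def TwoDim.{u', v'} {K : Type u'} [Field K] (_ : K) : Type (max u' v') := ULift.{v'} (K × K)

namespace TwoDim

variable {K : Type u} [Field K] {δ : K}

/-- The element `s • e + t • m`. -/
def pair (s t : K) : TwoDim.{u, v} δ := ULift.up (s, t)

/-- The coordinate at `e`. -/
def fst (x : TwoDim.{u, v} δ) : K := (ULift.down x).1

/-- The coordinate at `m`. -/
def snd (x : TwoDim.{u, v} δ) : K := (ULift.down x).2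

instance : AddCommGroup (TwoDim.{u, v} δ) := inferInstanceAs (AddCommGroup (ULift.{v} (K × K)))

instance : Module K (TwoDim.{u, v} δ) := inferInstanceAs (Module K (ULift.{v} (K × K)))

instance : Mul (TwoDim.{u, v} δ) := ⟨fun x y => pair (δ * (fst x * fst y)) (snd x * fst y)⟩

theorem ext {x y : TwoDim.{u, v} δ} (h : fst x = fst y) (h' : snd x = snd y) : x = y :=
  ULift.down_injective (Prod.ext h h')

@[simp] theorem fst_pair (s t : K) : fst (pair s t : TwoDim.{u, v} δ) = s := rfl
@[simp] theorem snd_pair (s t : K) : snd (pair s t : TwoDim.{u, v} δ) = t := rfl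
@[simp] theorem fst_add (x y : TwoDim.{u, v} δ) : fst (x + y) = fst x + fst y := rfl
@[simp] theorem snd_add (x y : TwoDim.{u, v} δ) : snd (x + y) = snd x + snd y := rfl
@[simp] theorem fst_sub (x y : TwoDim.{u, v} δ) : fst (x - y) = fst x - fst y := rfl
@[simp] theorem snd_sub (x y : TwoDim.{u, v} δ) : snd (x - y) = snd x - snd y := rfl
@[simp] theorem fst_zero : fst (0 : TwoDim.{u, v} δ) = 0 := rfl
@[simp] theorem snd_zero : snd (0 : TwoDim.{u, v} δ) = 0 := rfl
@[simp] theorem fst_smul (c : K) (x : TwoDim.{u, v} δ) : fst (c • x) = c * fst x := rfl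
@[simp] theorem snd_smul (c : K) (x : TwoDim.{u, v} δ) : snd (c • x) = c * snd x := rfl
@[simp] theorem fst_mul (x y : TwoDim.{u, v} δ) : fst (x * y) = δ * (fst x * fst y) := rfl
@[simp] theorem snd_mul (x y : TwoDim.{u, v} δ) : snd (x * y) = snd x * fst y := rfl

instance : NonUnitalNonAssocRing (TwoDim.{u, v} δ) where
  left_distrib x y z := by apply ext <;> simp <;> ring
  right_distrib x y z := by apply ext <;> simp <;> ring
  zero_mul x := by apply ext <;> simp
  mul_zero x := by apply ext <;> simp

instance : IsScalarTower K (TwoDim.{u, v} δ) (TwoDim.{u, v} δ) where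
  smul_assoc c x y := by apply ext <;> simp <;> ring

instance : SMulCommClass K (TwoDim.{u, v} δ) (TwoDim.{u, v} δ) where
  smul_comm c x y := by
    apply ext
    · simp only [smul_eq_mul, fst_smul, fst_mul]; ring
    · simp only [smul_eq_mul, snd_smul, snd_mul, fst_smul]; ring

theorem isDeltaNovikov : IsDeltaNovikov δ (TwoDim.{u, v} δ) where
  left_symm x y z := by apply ext <;> simp <;> ring
  right_comm x y z := by
    apply ext
    · simp only [fst_mul]; ring
    · simp only [snd_mul]; ring

/-- The coordinate at `m`, as a linear form on the commutator algebra. -/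
def sndLinear (δ : K) : CommutatorAlgebra (TwoDim.{u, v} δ) →ₗ[K] K where
  toFun x := snd (CommutatorAlgebra.of.symm x)
  map_add' _ _ := rfl
  map_smul' _ _ := rfl

/-- The generic substitution `x_k ↦ α k • (e + γ k • m)`. -/
def subst (δ : K) (α γ : ℕ → K) (k : ℕ) : CommutatorAlgebra (TwoDim.{u, v} δ) :=
  CommutatorAlgebra.of (pair (α k) (α k * γ k))

/-- The multidegree of the word enters only through `α`, and its first two letters only through
`γ i - γ k`; this is what tells normal forms apart. -/
theorem leftNormed_subst (α γ : ℕ → K) (i k : ℕ) (l : List ℕ) :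
    leftNormed (subst.{u, v} δ α γ) i k l
      = CommutatorAlgebra.of (pair 0 ((α i * α k * (γ i - γ k)) * (l.map α).prod)) := by
  have h : ∀ t, rightAct (subst.{u, v} δ α γ) (CommutatorAlgebra.of (pair 0 t)) l
      = CommutatorAlgebra.of (pair 0 (t * (l.map α).prod)) := by
    induction l with
    | nil => intro t; simp [rightAct]
    | cons b l ih =>
      intro t
      have hb : CommutatorAlgebra.of (pair 0 t) * subst.{u, v} δ α γ b
          = CommutatorAlgebra.of (pair 0 (t * α b)) := by
        rw [subst, CommutatorAlgebra.of_mul_of]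
        congr 1
        apply ext <;> simp
      refine (congrArg (rightAct (subst.{u, v} δ α γ) · l) hb).trans ((ih _).trans ?_)
      rw [List.map_cons, List.prod_cons, mul_assoc]
  have h2 : subst.{u, v} δ α γ i * subst.{u, v} δ α γ k
      = CommutatorAlgebra.of (pair 0 (α i * α k * (γ i - γ k))) := by
    rw [subst, subst, CommutatorAlgebra.of_mul_of]
    congr 1
    apply ext <;> simp <;> ring
  rw [leftNormed, h2, h]

end TwoDim

/-! ### Linear independence of the normal forms -/

section Independence

variable {K : Type u} [Field K]

/-- The linear map sending the monomial with multiset of letters `s`, placed at the index `i`, to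
the normal form attached to `s` and `i`. -/
noncomputable def toNormalForm (K : Type u) [Field K] : (ℕ →₀ MvPolynomial ℕ K) →ₗ[K] NAPoly K :=
  Finsupp.lsum K fun i => (MvPolynomial.basisMonomials ℕ K).constr K fun ν =>
    normalForm (NAPoly.X K) i (Finsupp.toMultiset ν)

/-- The linear map sending a family of polynomials `pᵢ` to the value `∑ᵢ γᵢ pᵢ(α)`. -/
noncomputable def evalFamily (α γ : ℕ → K) : (ℕ →₀ MvPolynomial ℕ K) →ₗ[K] K :=
  Finsupp.lsum K fun i => γ i • (MvPolynomial.aeval α).toLinearMap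

/-- The monomial with multiset of letters `s`. -/
noncomputable def letterMonomial (K : Type u) [Field K] (s : Multiset ℕ) : MvPolynomial ℕ K :=
  MvPolynomial.monomial (Multiset.toFinsupp s) 1

theorem toNormalForm_single (i : ℕ) (s : Multiset ℕ) :
    toNormalForm K (Finsupp.single i (letterMonomial K s)) = normalForm (NAPoly.X K) i s := by
  have h := (MvPolynomial.basisMonomials ℕ K).constr_basis K
    (fun ν => normalForm (NAPoly.X K) i (Finsupp.toMultiset ν)) (Multiset.toFinsupp s)
  rw [Multiset.toFinsupp_toMultiset, MvPolynomial.coe_basisMonomials] at h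
  rw [toNormalForm, Finsupp.lsum_single]
  exact h

theorem evalFamily_single (α γ : ℕ → K) (i : ℕ) (s : Multiset ℕ) :
    evalFamily α γ (Finsupp.single i (letterMonomial K s)) = γ i * (s.map α).prod := by
  have h : MvPolynomial.aeval α (letterMonomial K s) = (s.map α).prod := by
    rw [letterMonomial, MvPolynomial.aeval_monomial, map_one, one_mul]
    conv_rhs => rw [← Multiset.toFinsupp_toMultiset s, Finsupp.toMultiset_map,
      Finsupp.prod_toMultiset]
    rw [Finsupp.prod_mapDomain_index] <;> simp [pow_add]
  rw [evalFamily, Finsupp.lsum_single, LinearMap.smul_apply, AlgHom.toLinearMap_apply, h,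
    smul_eq_mul]

/-- Over an infinite field the values `∑ᵢ γᵢ pᵢ(α)` determine the family. -/
theorem eq_zero_of_evalFamily_eq_zero [Infinite K] {d : ℕ →₀ MvPolynomial ℕ K}
    (h : ∀ α γ, evalFamily α γ d = 0) : d = 0 := by
  ext1 i
  refine MvPolynomial.funext fun α => ?_
  have := h α (Pi.single i 1)
  rw [evalFamily, Finsupp.lsum_apply, Finsupp.sum_eq_single i] at this
  · simpa [MvPolynomial.aeval_eq_eval] using this
  · intro j _ hj
    simp [hj]
  · simp

/-- Every polynomial has a normal form modulo the metabelian Lie identities, and the family of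
polynomials that encodes it can be read off from the values of the polynomial in the commutator
algebra of `TwoDim δ`. -/
theorem exists_toNormalForm [CharZero K] {δ : K} (hδ : δ ≠ 1) (f : NAPoly K) :
    ∃ d, f - toNormalForm K d ∈ metabelianTIdeal K ∧ ∀ α γ,
      TwoDim.sndLinear δ
        (FreeNonUnitalNonAssocAlgebra.lift K (TwoDim.subst.{u, v} δ α γ) f)
          = evalFamily α γ d := by
  induction mem_span_spanningSet f using Submodule.span_induction with
  | zero => exact ⟨0, by simp, fun α γ => by simp⟩
  | add f g _ _ hf hg =>
    obtain ⟨d, hd, hd'⟩ := hf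
    obtain ⟨c, hc, hc'⟩ := hg
    refine ⟨d + c, ?_, fun α γ => by simp only [map_add, hd', hc']⟩
    rw [map_add, add_sub_add_comm]
    exact add_mem hd hc
  | smul r f _ hf =>
    obtain ⟨d, hd, hd'⟩ := hf
    refine ⟨r • d, ?_, fun α γ => by simp only [map_smul, hd']⟩
    rw [map_smul, ← smul_sub]
    exact Submodule.smul_mem _ r hd
  | mem f hf =>
    rcases hf with ⟨i, rfl⟩ | ⟨i, k, l, rfl⟩ | hf
    · refine ⟨Finsupp.single i (letterMonomial K {i}), ?_, fun α γ => ?_⟩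
      · rw [toNormalForm_single, normalForm, if_pos rfl, sub_self]
        exact zero_mem _
      · rw [evalFamily_single, FreeNonUnitalNonAssocAlgebra.lift_of_apply,
          Multiset.map_singleton, Multiset.prod_singleton, mul_comm]
        rfl
    -- A left-normed word is a difference of two normal forms, and its value is the corresponding
    -- difference of `γ i ∏ α` and `γ k ∏ α`.
    · set s : Multiset ℕ := i ::ₘ k ::ₘ (l : Multiset ℕ) with hs
      refine ⟨Finsupp.single i (letterMonomial K s) - Finsupp.single k (letterMonomial K s),
        ?_, fun α γ => ?_⟩
      · rw [map_sub, toNormalForm_single, toNormalForm_single, ← FreeMetabelian.mk_eq_iff,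
          map_sub, map_normalForm, map_normalForm, map_leftNormed]
        exact FreeMetabelian.isMetabelianLie.leftNormed_eq_normalForm_sub
          FreeMetabelian.mul_self i k l
      · have h := map_leftNormed
          (FreeNonUnitalNonAssocAlgebra.lift K (TwoDim.subst.{u, v} δ α γ) :
            NAPoly K →ₙ+* CommutatorAlgebra (TwoDim.{u, v} δ)) (NAPoly.X K) i k l
        have hX : (FreeNonUnitalNonAssocAlgebra.lift K (TwoDim.subst.{u, v} δ α γ) :
            NAPoly K →ₙ+* CommutatorAlgebra (TwoDim.{u, v} δ)) ∘ NAPoly.X K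
              = TwoDim.subst.{u, v} δ α γ :=
          FreeNonUnitalNonAssocAlgebra.of_comp_lift K _
        rw [hX, TwoDim.leftNormed_subst] at h
        refine (congrArg (TwoDim.sndLinear δ) h).trans ?_
        have h2 : (s.map α).prod = α i * (α k * (l.map α).prod) := by simp [hs]
        rw [map_sub, evalFamily_single, evalFamily_single, h2]
        change α i * α k * (γ i - γ k) * (l.map α).prod = _
        ring
    · refine ⟨0, by simpa using hf, fun α γ => ?_⟩
      rw [metabelianTIdeal_subset_commutatorIdentities.{u, v} hδ hf (TwoDim.{u, v} δ)
        TwoDim.isDeltaNovikov, map_zero, map_zero]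

end Independence

theorem mainTheorem1 {K : Type u} [Field K] [CharZero K] (δ : K) (hδ : δ ≠ 1) :
    (∀ f : NAPoly K, f ∈ commutatorIdentities.{u, v} δ ↔
      f ∈ identityConsequences {anticommPoly K, jacobiPoly K, metabelianPoly K}) ∧
    (∀ (A : Type w) [NonUnitalNonAssocRing A] [Module K A] [IsScalarTower K A A]
      [SMulCommClass K A A], MemCommutatorVariety.{u, v, w} δ A ↔ IsMetabelianLie A) := by
  have h1 : ∀ f : NAPoly K, f ∈ commutatorIdentities.{u, v} δ ↔
      f ∈ identityConsequences {anticommPoly K, jacobiPoly K, metabelianPoly K} := by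
    refine fun f => ⟨fun hf => ?_, metabelianTIdeal_subset_commutatorIdentities hδ⟩
    obtain ⟨d, hd, hev⟩ := exists_toNormalForm.{u, v} hδ f
    have hd0 : d = 0 := eq_zero_of_evalFamily_eq_zero fun α γ => by
      rw [← hev, hf (TwoDim.{u, v} δ) TwoDim.isDeltaNovikov, map_zero]
    rwa [hd0, map_zero, sub_zero] at hd
  refine ⟨h1, fun A _ _ _ _ => ⟨fun hA => ?_, fun hA f hf => ?_⟩⟩
  · exact isMetabelianLie_of_satisfiesIdentity fun f hf => hA f ((h1 f).2 hf)
  · exact hA.satisfiesIdentity ((h1 f).1 hf)
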